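/- Let $\Omega\subset\mathbb R^2$ be a bounded polygonal domain, let $\Gamma_N,\Gamma_D$ be disjoint measurable subsets of $\partial\Omega$ with $\Gamma_N\cup\Gamma_D=\partial\Omega$, let $f\in L^2(\Omega)$, $g_N\in L^2(\Gamma_N)$, and let $g_D$ be given on $\Gamma_D$. If $\Gamma_D\neq\emptyset$, put $$V=\{v\in H^1(\Omega):\ v=g_D\text{ on }\Gamma_D\},\qquad V_0=\{v\in H^1(\Omega):\ v=0\text{ on }\Gamma_D\}$$ (boundary values in the sense of traces); if $\Gamma_D=\emptyset$, put $V=V_0=\{v\in H^1(\Omega):\int_\Omega v\,dx=0\}$. Let $u\in V$ be a weak solution of $-\Delta u=f$ in $\Omega$, $\partial u/\partial\mathbf n=g_N$ on $\Gamma_N$, $u=g_D$ on $\Gamma_D$, that is, $$\int_\Omega\nabla u\cdot\nabla\varphi\,dx=\int_\Omega f\varphi\,dx+\int_{\Gamma_N}g_N\varphi\,ds\qquad\text{for all }\varphi\in V_0 .$$ Let $S\subset\Omega$ be open, $\varepsilon>0$ and $\Omega'=\{x\in\Omega:\ \mathrm{dist}(x,S)<\varepsilon\}$. Let $\alpha\in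 W^{1,\infty}(\Omega)$ satisfy $\alpha=1$ on $S$, $\alpha=0$ on $\Omega\setminus\Omega'$ and $0\le\alpha\le1$ on $\Omega'\setminus S$. Write $$\|h\|_\alpha=\Big(\int_{\Omega'}\alpha\,|h|^2\,dx\Big)^{1/2},\qquad \|h\|_{\Omega'}=\Big(\int_{\Omega'}|h|^2\,dx\Big)^{1/2},\qquad \|\nabla\alpha\|_{L^\infty(\Omega)}=\max_{i=1,2}\ \operatorname*{ess\,sup}_{\Omega}|\partial_i\alpha| .$$ Then for every $v\in V$ and every $\mathbf p\in H(\mathrm{div};\Omega)$ with $\mathrm{div}\,\mathbf p+f=0$ in $\Omega$ and $\mathbf p\cdot\mathbf n=g_N$ on $\Gamma_N$ (the latter meaning that $\int_\Omega(\mathbf p\cdot\nabla\varphi+\varphi\,\mathrm{div}\,\mathbf p)\,dx=\int_{\Gamma_N}g_N\varphi\,ds$ for all $\varphi\in H^1(\Omega)$ vanishing on $\Gamma_D$), $$\|\nabla u-\nabla v\|_\alpha^2+\|\nabla u-\mathbf p\|_\alpha^2\ \le\ \|\nabla v-\mathbf p\|_\alpha^2+2\sqrt2\,\|\nabla\alpha\|_{L^\infty(\Omega)}\,\|u-v\|_{\Omega'}\,\|\nabla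 u-\mathbf p\|_{\Omega'} .$$ -/

import Mathlib

open MeasureTheory Filter Topology
open scoped ENNReal ContDiff

noncomputable section

namespace WeightedHypercircle

/-- The Euclidean plane. -/
abbrev Plane : Type := EuclideanSpace ℝ (Fin 2)

/-- A bounded polygonal domain of the plane: a bounded, connected, nonempty open set whose closure
is the union of the simplices of a finite (conforming) triangulation, and which has no slits or
punctures (it is the interior of its closure). -/
structure IsPolygonalDomain (Ω : Set Plane) : Prop where
  isOpen : IsOpen Ω
  isConnected : IsConnected Ω
  isBounded : Bornology.IsBounded Ω
  interior_closure : interior (closure Ω) = Ω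
  triangulated : ∃ K : Geometry.SimplicialComplex ℝ Plane, K.faces.Finite ∧ K.space = closure Ω

/-- Test functions: smooth functions with compact support contained in `Ω`. -/
structure IsTestFunction (Ω : Set Plane) (φ : Plane → ℝ) : Prop where
  smooth : ContDiff ℝ ∞ φ
  hasCompactSupport : HasCompactSupport φ
  tsupport_subset : tsupport φ ⊆ Ω

/-- `G` is the weak (distributional) gradient of `u` in `Ω`. -/
def HasWeakGradient (Ω : Set Plane) (u : Plane → ℝ) (G : Plane → Plane) : Prop :=
  LocallyIntegrableOn u Ω ∧ LocallyIntegrableOn G Ω ∧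
    ∀ φ : Plane → ℝ, IsTestFunction Ω φ →
      ∫ x in Ω, u x • gradient φ x = -∫ x in Ω, φ x • G x

open Classical in
/-- The weak gradient of `u` in `Ω` (unique up to null sets; zero if there is none). -/
def weakGradient (Ω : Set Plane) (u : Plane → ℝ) : Plane → Plane :=
  if h : ∃ G, HasWeakGradient Ω u G then h.choose else 0

/-- `d` is the weak (distributional) divergence of the vector field `p` in `Ω`. -/
def HasWeakDivergence (Ω : Set Plane) (p : Plane → Plane) (d : Plane → ℝ) : Prop :=
  LocallyIntegrableOn p Ω ∧ LocallyIntegrableOn d Ω ∧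
    ∀ φ : Plane → ℝ, IsTestFunction Ω φ →
      ∫ x in Ω, inner ℝ (p x) (gradient φ x) = -∫ x in Ω, d x * φ x

open Classical in
/-- The weak divergence of `p` in `Ω` (unique up to null sets; zero if there is none). -/
def weakDivergence (Ω : Set Plane) (p : Plane → Plane) : Plane → ℝ :=
  if h : ∃ d, HasWeakDivergence Ω p d then h.choose else 0

/-- The Sobolev space `H¹(Ω)`. -/
def MemH1 (Ω : Set Plane) (u : Plane → ℝ) : Prop :=
  MemLp u 2 (volume.restrict Ω) ∧
    ∃ G, HasWeakGradient Ω u G ∧ MemLp G 2 (volume.restrict Ω)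

/-- The Sobolev space `W^{1,∞}(Ω)`. -/
def MemW1Infty (Ω : Set Plane) (a : Plane → ℝ) : Prop :=
  MemLp a ∞ (volume.restrict Ω) ∧
    ∃ G, HasWeakGradient Ω a G ∧ MemLp G ∞ (volume.restrict Ω)

/-- The space `H(div; Ω)`. -/
def MemHDiv (Ω : Set Plane) (p : Plane → Plane) : Prop :=
  MemLp p 2 (volume.restrict Ω) ∧
    ∃ d, HasWeakDivergence Ω p d ∧ MemLp d 2 (volume.restrict Ω)

/-- Arc length on the boundary: one-dimensional Hausdorff measure. -/
def arcLength : Measure Plane := Measure.hausdorffMeasure 1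

/-- The Sobolev function `u` on `Ω` has the boundary value `a` at the boundary point `x`, in the
trace sense: the mean of `|u - a|` over `B(x, r) ∩ Ω` tends to `0` as `r → 0`.
For `u ∈ H¹(Ω)` on a polygonal domain this holds at almost every boundary point `x` with `a` the
value at `x` of the `L²(∂Ω)` trace of `u`. -/
def HasTraceAt (Ω : Set Plane) (u : Plane → ℝ) (x : Plane) (a : ℝ) : Prop :=
  Tendsto (fun r : ℝ => ⨍ y in Metric.ball x r ∩ Ω, |u y - a|) (𝓝[>] 0) (𝓝 0)

/-- `u = g` on the part `Γ` of the boundary, in the sense of traces. -/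
def TraceEqOn (Ω : Set Plane) (u : Plane → ℝ) (Γ : Set Plane) (g : Plane → ℝ) : Prop :=
  ∀ᵐ x ∂(arcLength.restrict Γ), HasTraceAt Ω u x (g x)

open Classical in
/-- The boundary trace of `u` (with value zero at the exceptional boundary points). -/
def trace (Ω : Set Plane) (u : Plane → ℝ) (x : Plane) : ℝ :=
  if h : ∃ a, HasTraceAt Ω u x a then h.choose else 0

/-- The trial space `V`: functions in `H¹(Ω)` equal to `gD` on `ΓD`; if `ΓD` is empty, functions in
`H¹(Ω)` with mean value zero. -/
def trialSpace (Ω ΓD : Set Plane) (gD : Plane → ℝ) : Set (Plane → ℝ) :=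
  {v | MemH1 Ω v ∧ TraceEqOn Ω v ΓD gD ∧ (ΓD = ∅ → ∫ x in Ω, v x = 0)}

/-- The test space `V₀`. -/
def testSpace (Ω ΓD : Set Plane) : Set (Plane → ℝ) :=
  trialSpace Ω ΓD 0

/-- `u` is the (weak) solution of `-Δu = f` in `Ω`, `∂u/∂n = gN` on `ΓN`, `u = gD` on `ΓD`. -/
def IsWeakSolution (Ω ΓD ΓN : Set Plane) (f gD gN u : Plane → ℝ) : Prop :=
  u ∈ trialSpace Ω ΓD gD ∧
    ∀ φ ∈ testSpace Ω ΓD,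
      ∫ x in Ω, inner ℝ (weakGradient Ω u x) (weakGradient Ω φ x) =
        (∫ x in Ω, f x * φ x) + ∫ x in ΓN, gN x * trace Ω φ x ∂arcLength

/-- The normal trace of a field `p ∈ H(div; Ω)` as a functional on `H¹(Ω)`:
`⟨p · n, φ⟩ = ∫_Ω p · ∇φ + ∫_Ω φ div p`. By the divergence theorem it is `∫_∂Ω (p · n) φ ds`, with
`n` the outer unit normal, for fields smooth up to the boundary. -/
def normalTrace (Ω : Set Plane) (p : Plane → Plane) (φ : Plane → ℝ) : ℝ :=
  (∫ x in Ω, inner ℝ (p x) (weakGradient Ω φ x)) + ∫ x in Ω, weakDivergence Ω p x * φ x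

/-- `p · n = g` on the part `Γ` of the boundary `∂Ω`, for `p ∈ H(div; Ω)`: the normal trace of `p`
agrees with `φ ↦ ∫_Γ g φ ds` on all `φ ∈ H¹(Ω)` that vanish on the rest of the boundary. -/
def NormalTraceEqOn (Ω : Set Plane) (p : Plane → Plane) (Γ : Set Plane) (g : Plane → ℝ) : Prop :=
  ∀ φ : Plane → ℝ, MemH1 Ω φ → TraceEqOn Ω φ (frontier Ω \ Γ) 0 →
    normalTrace Ω p φ = ∫ x in Γ, g x * trace Ω φ x ∂arcLength

/-- The extended domain `Ω' = {x ∈ Ω ; dist(x, S) < ε}`. -/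
def extendedDomain (Ω S : Set Plane) (ε : ℝ) : Set Plane :=
  Ω ∩ Metric.thickening ε S

/-- `α` is a weight (cutoff) function for `S`: it lies in `W^{1,∞}(Ω)`, is `1` on `S`, vanishes
outside `Ω'`, and takes values in `[0, 1]` in the band `Ω' \ S`. -/
structure IsCutoff (Ω S : Set Plane) (ε : ℝ) (α : Plane → ℝ) : Prop where
  memW1Infty : MemW1Infty Ω α
  eq_one : ∀ x ∈ S, α x = 1
  eq_zero : ∀ x ∈ Ω \ extendedDomain Ω S ε, α x = 0
  mem_Icc : ∀ x ∈ extendedDomain Ω S ε \ S, α x ∈ Set.Icc (0 : ℝ) 1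

/-- The norm of `L²(A)`, for scalar or vector valued functions. -/
def normL2 {F : Type*} [NormedAddCommGroup F] (A : Set Plane) (h : Plane → F) : ℝ :=
  Real.sqrt (∫ x in A, ‖h x‖ ^ 2)

/-- The weighted norm `(∫_A α |h|² dx)^{1/2}`, for scalar or vector valued functions. -/
def weightedNorm {F : Type*} [NormedAddCommGroup F] (A : Set Plane) (α : Plane → ℝ)
    (h : Plane → F) : ℝ :=
  Real.sqrt (∫ x in A, α x * ‖h x‖ ^ 2)

/-- The norm `‖∇a‖_{L^∞(Ω)} = max_i ess sup_Ω |∂_i a|` (the codomain `Fin 2 → ℝ` carries the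
maximum norm). -/
def gradientSupNorm (Ω : Set Plane) (a : Plane → ℝ) : ℝ :=
  (eLpNorm (fun x => (fun i => weakGradient Ω a x i : Fin 2 → ℝ)) ∞ (volume.restrict Ω)).toReal

end WeightedHypercircle

end

open WeightedHypercircle

namespace WeightedHypercircle

open scoped Convolution

/-! ### Test functions -/

/-! Write `E = ∇u - ∇v`, `q = ∇u - p` and `e = u - v`. Since `∇v - p = q - E`, expanding the square
gives `|E|² + |q|² = |∇v - p|² + 2 q·E` pointwise, so the whole estimate is a bound for `∫ α q·E`.

For `α = 1` on all of `Ω` this integral would vanish (the hypercircle identity): subtracting the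
normal trace identity for `p` from the weak equation for `u` shows that `q` is orthogonal to the
gradients of all test functions (`setIntegral_inner_weakGradient_sub_eq_zero`). In the weighted case
`α e`, shifted by its mean if `ΓD` is empty, is still a test function, and the product rule turns
orthogonality into `∫ α q·E = -∫ e q·∇α` (`setIntegral_cutoff_mul_inner_eq`). As `∇α` lives on `Ω'`
and `|∇α| ≤ √2 max |∂ᵢα|`, Cauchy-Schwarz finishes.

Three facts carry the analysis: the product rule for weak gradients, by mollifying the bounded
factor (`HasWeakGradient.mul`); the vanishing of `∇α` almost everywhere off `Ω'`, which includes the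
level set `dist(·, S) = ε` (`volume_infDist_eq_const`); and the zero trace of `α e` on `ΓD`
(`HasTraceAt.mul_sub`). -/

lemma gradient_mul {φ ψ : Plane → ℝ} {x : Plane} (hφ : DifferentiableAt ℝ φ x)
    (hψ : DifferentiableAt ℝ ψ x) :
    gradient (fun y => φ y * ψ y) x = φ x • gradient ψ x + ψ x • gradient φ x := by
  refine ext_inner_right ℝ fun w => ?_
  rw [inner_gradient_left, inner_add_left, real_inner_smul_left, real_inner_smul_left,
    inner_gradient_left, inner_gradient_left, fderiv_fun_mul hφ hψ]
  simp

lemma IsTestFunction.continuous_gradient {Ω : Set Plane} {φ : Plane → ℝ}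
    (hφ : IsTestFunction Ω φ) : Continuous (gradient φ) :=
  (InnerProductSpace.toDual ℝ Plane).symm.continuous.comp
    (hφ.smooth.continuous_fderiv (by simp))

lemma gradient_eq_zero_of_notMem_tsupport {φ : Plane → ℝ} {x : Plane} (hx : x ∉ tsupport φ) :
    gradient φ x = 0 := by
  refine ext_inner_right ℝ fun w => ?_
  rw [inner_gradient_left, fderiv_of_notMem_tsupport ℝ hx]
  simp

lemma IsTestFunction.hasCompactSupport_gradient {Ω : Set Plane} {φ : Plane → ℝ}
    (hφ : IsTestFunction Ω φ) : HasCompactSupport (gradient φ) := by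
  refine HasCompactSupport.of_support_subset_isCompact hφ.hasCompactSupport fun x hx => ?_
  by_contra h
  exact hx (gradient_eq_zero_of_notMem_tsupport h)

lemma IsTestFunction.exists_bound {Ω : Set Plane} {φ : Plane → ℝ} (hφ : IsTestFunction Ω φ) :
    ∃ C, ∀ x, ‖φ x‖ ≤ C :=
  hφ.hasCompactSupport.exists_bound_of_continuous hφ.smooth.continuous

lemma IsTestFunction.exists_bound_gradient {Ω : Set Plane} {φ : Plane → ℝ}
    (hφ : IsTestFunction Ω φ) : ∃ C, ∀ x, ‖gradient φ x‖ ≤ C :=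
  hφ.hasCompactSupport_gradient.exists_bound_of_continuous hφ.continuous_gradient

lemma IsTestFunction.integrable_smul {Ω : Set Plane} {φ : Plane → ℝ} {G : Plane → Plane}
    (hφ : IsTestFunction Ω φ) (hG : IntegrableOn G Ω) :
    Integrable (fun x => φ x • G x) (volume.restrict Ω) := by
  obtain ⟨C, hC⟩ := hφ.exists_bound
  exact Integrable.bdd_smul hG C hφ.smooth.continuous.aestronglyMeasurable (.of_forall hC)

lemma IsTestFunction.integrable_smul_gradient {Ω : Set Plane} {φ u : Plane → ℝ}
    (hφ : IsTestFunction Ω φ) (hu : IntegrableOn u Ω) :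
    Integrable (fun x => u x • gradient φ x) (volume.restrict Ω) := by
  obtain ⟨C, hC⟩ := hφ.exists_bound_gradient
  exact Integrable.smul_bdd hu C hφ.continuous_gradient.aestronglyMeasurable (.of_forall hC)

/-! ### Mollification of weakly differentiable functions -/

/-- The derivative falls on the kernel, and `y ↦ ρ(x - y)` is itself a test function in `Ω` because
the closed ball around `x` lies inside. Testing the weak gradient against it gives the claim; the
minus sign of the chain rule cancels that of integration by parts. The jump of the zero extension
across the boundary is never seen. -/
lemma HasWeakGradient.gradient_convolution {Ω : Set Plane} {a : Plane → ℝ} {A : Plane → Plane}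
    (hΩ : IsOpen Ω) (ha : HasWeakGradient Ω a A) (hai : IntegrableOn a Ω)
    (ρ : ContDiffBump (0 : Plane)) {x : Plane}
    (hx : Metric.closedBall x ρ.rOut ⊆ Ω) :
    gradient (ρ.normed volume ⋆[ContinuousLinearMap.lsmul ℝ ℝ, volume] Ω.indicator a) x =
      (ρ.normed volume ⋆[ContinuousLinearMap.lsmul ℝ ℝ, volume] Ω.indicator A) x := by
  set f : Plane → ℝ := ρ.normed volume with hf
  have hfs : ContDiff ℝ ∞ f := ρ.contDiff_normed
  have hfd : Differentiable ℝ f := hfs.differentiable (by simp)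
  have hfc : HasCompactSupport f := ρ.hasCompactSupport_normed
  have hsupp : tsupport (fun y => f (x - y)) ⊆ Metric.closedBall x ρ.rOut := by
    refine closure_minimal (fun y hy => ?_) Metric.isClosed_closedBall
    have : x - y ∈ Metric.ball (0 : Plane) ρ.rOut := by
      rw [← ρ.support_normed_eq (μ := volume)]
      exact hy
    rw [mem_ball_zero_iff] at this
    rw [Metric.mem_closedBall, dist_comm, dist_eq_norm]
    exact this.le
  have hψ : IsTestFunction Ω (fun y => f (x - y)) :=
    ⟨hfs.comp (contDiff_const.sub contDiff_id),
      HasCompactSupport.of_support_subset_isCompact (isCompact_closedBall x ρ.rOut)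
        ((subset_tsupport _).trans hsupp), hsupp.trans hx⟩
  have hind : LocallyIntegrable (Ω.indicator a) volume :=
    ((integrable_indicator_iff hΩ.measurableSet).2 hai).locallyIntegrable
  have hderiv : ∀ y w, fderiv ℝ (fun y => f (x - y)) y w = -fderiv ℝ f (x - y) w := by
    intro y w
    have h1 : HasFDerivAt (fun y : Plane => x - y) (-(ContinuousLinearMap.id ℝ Plane)) y :=
      (hasFDerivAt_id y).const_sub x
    have h2 := (hfd (x - y)).hasFDerivAt.comp y h1
    have h3 : HasFDerivAt (fun y => f (x - y)) _ y := h2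
    rw [h3.fderiv]
    simp
  have hconvint : Integrable (fun t => ((ContinuousLinearMap.lsmul ℝ ℝ).precompL Plane
      (fderiv ℝ f (x - t))) (Ω.indicator a t)) volume :=
    ((hfc.fderiv ℝ).convolutionExists_left _ (hfs.continuous_fderiv (by simp)) hind
      x).integrable_swap
  refine ext_inner_right ℝ fun w => ?_
  rw [inner_gradient_left, (hfc.hasFDerivAt_convolution_left (ContinuousLinearMap.lsmul ℝ ℝ)
    (hfs.of_le (by simp)) hind x).fderiv, convolution_eq_swap,
    ContinuousLinearMap.integral_apply hconvint, convolution_lsmul_swap]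
  have key := ha.2.2 _ hψ
  have hL : ∫ t, ((ContinuousLinearMap.lsmul ℝ ℝ).precompL Plane
      (fderiv ℝ f (x - t))) (Ω.indicator a t) w =
      -inner ℝ w (∫ y in Ω, a y • gradient (fun y => f (x - y)) y) := by
    rw [← integral_inner (hψ.integrable_smul_gradient hai), ← integral_neg,
      ← integral_indicator hΩ.measurableSet]
    congr 1
    ext t
    by_cases ht : t ∈ Ω
    · simp [ht, real_inner_smul_right, hderiv, mul_comm]
    · simp [ht]
  have hR : ∫ t, f (x - t) • Ω.indicator A t = ∫ y in Ω, f (x - y) • A y := by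
    rw [← integral_indicator hΩ.measurableSet]
    congr 1
    ext1 t
    by_cases ht : t ∈ Ω <;> simp [ht]
  rw [hL, hR, key, inner_neg_right, neg_neg, real_inner_comm]

lemma norm_convolution_normed_le {F : Type*} [NormedAddCommGroup F] [NormedSpace ℝ F]
    (ρ : ContDiffBump (0 : Plane)) {g : Plane → F} {M : ℝ} (hg : ∀ᵐ x, ‖g x‖ ≤ M)
    (x : Plane) :
    ‖(ρ.normed volume ⋆[ContinuousLinearMap.lsmul ℝ ℝ, volume] g) x‖ ≤ M := by
  rw [convolution_lsmul]
  have hg' : ∀ᵐ t : Plane, ‖g (x - t)‖ ≤ M :=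
    (quasiMeasurePreserving_sub_left_of_right_invariant volume x).ae hg
  calc ‖∫ t, ρ.normed volume t • g (x - t)‖ ≤ ∫ t, ρ.normed volume t • M := by
        refine norm_integral_le_of_norm_le (ρ.integrable_normed.smul_const M) ?_
        filter_upwards [hg'] with t ht
        rw [norm_smul, Real.norm_of_nonneg (ρ.nonneg_normed t), smul_eq_mul]
        exact mul_le_mul_of_nonneg_left ht (ρ.nonneg_normed t)
    _ = M := ρ.integral_normed_smul volume M

lemma MemLp.exists_ae_bound_indicator {F : Type*} [NormedAddCommGroup F] {Ω : Set Plane}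
    {g : Plane → F} (hΩ : MeasurableSet Ω) (hg : MemLp g ⊤ (volume.restrict Ω)) :
    ∃ M, ∀ᵐ x, ‖Ω.indicator g x‖ ≤ M := by
  have h := (memLp_indicator_iff_restrict hΩ).2 hg
  refine ⟨(eLpNorm (Ω.indicator g) ⊤ volume).toReal, ?_⟩
  filter_upwards [ae_le_eLpNormEssSup (μ := volume) (f := Ω.indicator g)] with x hx
  rw [← eLpNorm_exponent_top] at hx
  exact (ENNReal.ofReal_le_iff_le_toReal h.2.ne).1 (by rwa [ofReal_norm])

/-- The product rule for an integrable weakly differentiable function and a function in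
`W^{1,∞}`. -/
lemma HasWeakGradient.mul {Ω : Set Plane} {a e : Plane → ℝ} {A E : Plane → Plane}
    (hΩ : IsOpen Ω) (hvol : volume Ω ≠ ⊤) (ha : HasWeakGradient Ω a A)
    (ha' : MemLp a ∞ (volume.restrict Ω)) (hA' : MemLp A ∞ (volume.restrict Ω))
    (he : HasWeakGradient Ω e E) (hei : IntegrableOn e Ω) (hEi : IntegrableOn E Ω) :
    HasWeakGradient Ω (fun x => a x * e x) (fun x => a x • E x + e x • A x) := by
  have : IsFiniteMeasure (volume.restrict Ω) := ⟨by simpa using hvol.lt_top⟩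
  have hai : IntegrableOn a Ω := memLp_one_iff_integrable.1 (ha'.mono_exponent le_top)
  have hAi : IntegrableOn A Ω := memLp_one_iff_integrable.1 (hA'.mono_exponent le_top)
  obtain ⟨Ma, hMa⟩ := MemLp.exists_ae_bound_indicator hΩ.measurableSet ha'
  obtain ⟨MA, hMA⟩ := MemLp.exists_ae_bound_indicator hΩ.measurableSet hA'
  have hMa' : ∀ᵐ x ∂volume.restrict Ω, ‖a x‖ ≤ Ma := by
    rw [ae_restrict_iff' hΩ.measurableSet]
    filter_upwards [hMa] with x hx hxΩ
    simpa [hxΩ] using hx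
  have hMA' : ∀ᵐ x ∂volume.restrict Ω, ‖A x‖ ≤ MA := by
    rw [ae_restrict_iff' hΩ.measurableSet]
    filter_upwards [hMA] with x hx hxΩ
    simpa [hxΩ] using hx
  have hae : IntegrableOn (fun x => a x * e x) Ω := Integrable.bdd_mul hei ha'.1 hMa'
  have haE : IntegrableOn (fun x => a x • E x) Ω := Integrable.bdd_smul hEi Ma ha'.1 hMa'
  have heA : IntegrableOn (fun x => e x • A x) Ω := Integrable.smul_bdd hei MA hA'.1 hMA'
  refine ⟨hae.locallyIntegrableOn, (haE.add heA).locallyIntegrableOn, fun φ hφ => ?_⟩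
  have hain : Integrable (Ω.indicator a) volume := (integrable_indicator_iff hΩ.measurableSet).2 hai
  have hAin : Integrable (Ω.indicator A) volume := (integrable_indicator_iff hΩ.measurableSet).2 hAi
  -- Radii tend to zero with fixed ratio 2, the bounded eccentricity needed for almost everywhere
  -- convergence of the mollifications.
  let ρ : ℕ → ContDiffBump (0 : Plane) := fun n =>
    ⟨1 / (n + 1 : ℝ), 2 * (1 / (n + 1 : ℝ)), by positivity,
      by have : (0 : ℝ) < 1 / (n + 1 : ℝ) := by positivity
         linarith⟩
  have hρ : Tendsto (fun n => (ρ n).rOut) atTop (𝓝 0) := by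
    have h := (tendsto_one_div_add_atTop_nhds_zero_nat (𝕜 := ℝ)).const_mul 2
    rwa [mul_zero] at h
  have hρ' : ∀ᶠ n in atTop, (ρ n).rOut ≤ 2 * (ρ n).rIn := .of_forall fun n => le_rfl
  let an : ℕ → Plane → ℝ := fun n =>
    (ρ n).normed volume ⋆[ContinuousLinearMap.lsmul ℝ ℝ, volume] Ω.indicator a
  let An : ℕ → Plane → Plane := fun n =>
    (ρ n).normed volume ⋆[ContinuousLinearMap.lsmul ℝ ℝ, volume] Ω.indicator A
  have hansmooth : ∀ n, ContDiff ℝ ∞ (an n) := fun n =>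
    (ρ n).hasCompactSupport_normed.contDiff_convolution_left _ (ρ n).contDiff_normed
      hain.locallyIntegrable
  have hAncont : ∀ n, Continuous (An n) := fun n =>
    (ρ n).hasCompactSupport_normed.continuous_convolution_left _ (ρ n).continuous_normed
      hAin.locallyIntegrable
  have hanlim : ∀ᵐ x ∂volume.restrict Ω, Tendsto (fun n => an n x) atTop (𝓝 (a x)) := by
    rw [ae_restrict_iff' hΩ.measurableSet]
    filter_upwards [ContDiffBump.ae_convolution_tendsto_right_of_locallyIntegrable hρ hρ'
      hain.locallyIntegrable] with x hx hxΩ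
    simpa [hxΩ] using hx
  have hAnlim : ∀ᵐ x ∂volume.restrict Ω, Tendsto (fun n => An n x) atTop (𝓝 (A x)) := by
    rw [ae_restrict_iff' hΩ.measurableSet]
    filter_upwards [ContDiffBump.ae_convolution_tendsto_right_of_locallyIntegrable hρ hρ'
      hAin.locallyIntegrable] with x hx hxΩ
    simpa [hxΩ] using hx
  -- The compact support of `φ` keeps a positive distance from the complement of `Ω`; once the
  -- mollification radius is below it, gradient and mollification commute there.
  have hgrad : ∀ᶠ n in atTop, ∀ x ∈ tsupport φ, gradient (an n) x = An n x := by
    obtain ⟨δ, hδ, hδ'⟩ := hφ.hasCompactSupport.isCompact.exists_cthickening_subset_open hΩ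
      hφ.tsupport_subset
    filter_upwards [hρ.eventually (eventually_le_nhds hδ)] with n hn x hx
    exact ha.gradient_convolution hΩ hai (ρ n)
      ((Metric.closedBall_subset_closedBall hn).trans
        ((Metric.closedBall_subset_cthickening hx δ).trans hδ'))
  have htest : ∀ n, IsTestFunction Ω (fun x => an n x * φ x) := fun n =>
    ⟨(hansmooth n).mul hφ.smooth, hφ.hasCompactSupport.mul_left,
      (tsupport_mul_subset_right).trans hφ.tsupport_subset⟩
  obtain ⟨C, hC⟩ := hφ.exists_bound
  obtain ⟨D, hD⟩ := hφ.exists_bound_gradient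
  have hφm := hφ.smooth.continuous.aestronglyMeasurable (μ := volume.restrict Ω)
  have hgm := hφ.continuous_gradient.aestronglyMeasurable (μ := volume.restrict Ω)
  have hbx : ∀ n x, ‖an n x‖ ≤ Ma := fun n x => norm_convolution_normed_le (ρ n) hMa x
  have hBx : ∀ n x, ‖An n x‖ ≤ MA := fun n x => norm_convolution_normed_le (ρ n) hMA x
  have hMa0 : 0 ≤ Ma := (norm_nonneg _).trans (hbx 0 0)
  have hMA0 : 0 ≤ MA := (norm_nonneg _).trans (hBx 0 0)
  have hC0 : 0 ≤ C := (norm_nonneg _).trans (hC 0)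
  have hD0 : 0 ≤ D := (norm_nonneg _).trans (hD 0)
  -- Only `a` is mollified. Its mollifications and their gradients on the support of `φ` are bounded
  -- uniformly in `n`, so integrability of `e` and `E` suffices for dominated convergence.
  have hlimL : Tendsto (fun n => ∫ x in Ω, e x • (an n x • gradient φ x + φ x • An n x)) atTop
      (𝓝 (∫ x in Ω, e x • (a x • gradient φ x + φ x • A x))) := by
    refine tendsto_integral_of_dominated_convergence (fun x => ‖e x‖ * (Ma * D + C * MA))
      (fun n => ?_) (hei.norm.mul_const _) (fun n => .of_forall fun x => ?_) ?_
    · exact hei.1.smul (((hansmooth n).continuous.aestronglyMeasurable.smul hgm).add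
        (hφm.smul (hAncont n).aestronglyMeasurable))
    · rw [norm_smul]
      refine mul_le_mul_of_nonneg_left ((norm_add_le _ _).trans ?_) (norm_nonneg _)
      rw [norm_smul, norm_smul]
      gcongr
      · exact hbx n x
      · exact hD x
      · exact hC x
      · exact hBx n x
    · filter_upwards [hanlim, hAnlim] with x h1 h2
      exact ((h1.smul_const _).add (h2.const_smul _)).const_smul _
  have hlimR : Tendsto (fun n => -∫ x in Ω, (an n x * φ x) • E x) atTop
      (𝓝 (-∫ x in Ω, (a x * φ x) • E x)) := by
    refine (tendsto_integral_of_dominated_convergence (fun x => Ma * C * ‖E x‖)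
      (fun n => ?_) (hEi.norm.const_mul _) (fun n => .of_forall fun x => ?_) ?_).neg
    · exact ((hansmooth n).continuous.aestronglyMeasurable.mul hφm).smul hEi.1
    · rw [norm_smul, norm_mul]
      gcongr
      · exact hbx n x
      · exact hC x
    · filter_upwards [hanlim] with x h1
      exact (h1.mul_const _).smul_const _
  -- This is the weak gradient identity of `e` tested with the smooth function `an n * φ`.
  have hev : ∀ᶠ n in atTop, ∫ x in Ω, e x • (an n x • gradient φ x + φ x • An n x) =
      -∫ x in Ω, (an n x * φ x) • E x := by
    filter_upwards [hgrad] with n hn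
    rw [← he.2.2 _ (htest n)]
    congr 1
    ext1 x
    rw [gradient_mul ((hansmooth n).differentiable (by simp) x)
      (hφ.smooth.differentiable (by simp) x)]
    by_cases hx : x ∈ tsupport φ
    · rw [hn x hx]
    · simp [image_eq_zero_of_notMem_tsupport hx]
  have hlim := tendsto_nhds_unique (hlimL.congr' hev) hlimR
  have i1 : Integrable (fun x => (a x * e x) • gradient φ x) (volume.restrict Ω) :=
    hφ.integrable_smul_gradient hae
  have i2 : Integrable (fun x => φ x • e x • A x) (volume.restrict Ω) := hφ.integrable_smul heA
  have i3 : Integrable (fun x => φ x • a x • E x) (volume.restrict Ω) := hφ.integrable_smul haE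
  have e1 : ∫ x in Ω, e x • (a x • gradient φ x + φ x • A x) =
      (∫ x in Ω, (a x * e x) • gradient φ x) + ∫ x in Ω, φ x • e x • A x := by
    rw [← integral_add i1 i2]
    congr 1
    ext1 x
    module
  have e2 : ∫ x in Ω, (a x * φ x) • E x = ∫ x in Ω, φ x • a x • E x := by
    congr 1
    ext1 x
    module
  have e3 : ∫ x in Ω, φ x • (a x • E x + e x • A x) =
      (∫ x in Ω, φ x • a x • E x) + ∫ x in Ω, φ x • e x • A x := by
    simp only [smul_add]
    exact integral_add i3 i2
  rw [e1, e2] at hlim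
  rw [e3, neg_add, ← hlim]
  abel

/-! ### Uniqueness and linearity of weak gradients -/

lemma IsTestFunction.setIntegral_smul_eq {Ω : Set Plane} {φ : Plane → ℝ} (G : Plane → Plane)
    (hφ : IsTestFunction Ω φ) : ∫ x in Ω, φ x • G x = ∫ x, φ x • G x :=
  setIntegral_eq_integral_of_forall_compl_eq_zero fun x hx => by
    rw [image_eq_zero_of_notMem_tsupport fun h => hx (hφ.tsupport_subset h), zero_smul]

/-- The fundamental lemma of the calculus of variations, applied to the difference. It frees the
later arguments from the choice made in `weakGradient`. -/
lemma HasWeakGradient.ae_eq {Ω : Set Plane} {u : Plane → ℝ} {G H : Plane → Plane}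
    (hΩ : IsOpen Ω) (hG : HasWeakGradient Ω u G) (hH : HasWeakGradient Ω u H) :
    G =ᵐ[volume.restrict Ω] H := by
  have h := hΩ.ae_eq_zero_of_integral_contDiff_smul_eq_zero (f := fun x => G x - H x)
    (hG.2.1.sub hH.2.1) fun φ h1 h2 h3 => ?_
  · rw [Filter.EventuallyEq, ae_restrict_iff' hΩ.measurableSet]
    filter_upwards [h] with x hx hxΩ
    exact sub_eq_zero.1 (hx hxΩ)
  · have hφ : IsTestFunction Ω φ := ⟨h1, h2, h3⟩
    have key : ∀ K : Plane → Plane, LocallyIntegrableOn K Ω →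
        Integrable (fun x => φ x • K x) volume := fun K hK => by
      obtain ⟨C, hC⟩ := hφ.exists_bound
      refine (integrableOn_iff_integrable_of_support_subset (s := tsupport φ) fun x hx => ?_).1
        (Integrable.bdd_smul (hK.integrableOn_compact_subset h3 h2) C
          h1.continuous.aestronglyMeasurable (.of_forall hC))
      by_contra h
      exact hx (by simp [image_eq_zero_of_notMem_tsupport h])
    simp only [smul_sub]
    rw [integral_sub (key G hG.2.1) (key H hH.2.1), ← hφ.setIntegral_smul_eq G,
      ← hφ.setIntegral_smul_eq H, sub_eq_zero, ← neg_inj, ← hG.2.2 φ hφ, hH.2.2 φ hφ]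

/-- A weak gradient vanishes almost everywhere on each open set on which the function vanishes. -/
lemma HasWeakGradient.ae_eq_zero {Ω U : Set Plane} {u : Plane → ℝ} {G : Plane → Plane}
    (hG : HasWeakGradient Ω u G) (hU : IsOpen U) (hUΩ : U ⊆ Ω) (hu : ∀ x ∈ U, u x = 0) :
    ∀ᵐ x, x ∈ U → G x = 0 := by
  refine hU.ae_eq_zero_of_integral_contDiff_smul_eq_zero (hG.2.1.mono_set hUΩ)
    fun φ h1 h2 h3 => ?_
  have hφ : IsTestFunction Ω φ := ⟨h1, h2, h3.trans hUΩ⟩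
  rw [← hφ.setIntegral_smul_eq, ← neg_eq_zero, ← hG.2.2 φ hφ]
  refine integral_eq_zero_of_ae (.of_forall fun x => ?_)
  by_cases hx : x ∈ tsupport φ
  · simp [hu x (h3 hx)]
  · simp [gradient_eq_zero_of_notMem_tsupport hx]

lemma hasWeakGradient_weakGradient {Ω : Set Plane} {u : Plane → ℝ} {G : Plane → Plane}
    (hG : HasWeakGradient Ω u G) : HasWeakGradient Ω u (weakGradient Ω u) := by
  have h : ∃ G, HasWeakGradient Ω u G := ⟨G, hG⟩
  rw [weakGradient, dif_pos h]
  exact h.choose_spec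

lemma weakGradient_ae_eq {Ω : Set Plane} {u : Plane → ℝ} {G : Plane → Plane} (hΩ : IsOpen Ω)
    (hG : HasWeakGradient Ω u G) : weakGradient Ω u =ᵐ[volume.restrict Ω] G :=
  (hasWeakGradient_weakGradient hG).ae_eq hΩ hG

lemma memLp_weakGradient {Ω : Set Plane} {u : Plane → ℝ} {G : Plane → Plane} {q : ℝ≥0∞}
    (hΩ : IsOpen Ω) (hG : HasWeakGradient Ω u G) (hG' : MemLp G q (volume.restrict Ω)) :
    MemLp (weakGradient Ω u) q (volume.restrict Ω) :=
  hG'.ae_eq (weakGradient_ae_eq hΩ hG).symm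

lemma HasWeakGradient.sub {Ω : Set Plane} {u v : Plane → ℝ} {G H : Plane → Plane}
    (hG : HasWeakGradient Ω u G) (hH : HasWeakGradient Ω v H) (hu : IntegrableOn u Ω)
    (hv : IntegrableOn v Ω) (hGi : IntegrableOn G Ω) (hHi : IntegrableOn H Ω) :
    HasWeakGradient Ω (fun x => u x - v x) (fun x => G x - H x) := by
  refine ⟨hG.1.sub hH.1, hG.2.1.sub hH.2.1, fun φ hφ => ?_⟩
  simp only [sub_smul, smul_sub]
  rw [integral_sub (hφ.integrable_smul_gradient hu) (hφ.integrable_smul_gradient hv),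
    integral_sub (hφ.integrable_smul hGi) (hφ.integrable_smul hHi), hG.2.2 φ hφ, hH.2.2 φ hφ]
  abel

/-- Needed to subtract the mean value from a test function when `ΓD` is empty. -/
lemma hasWeakGradient_const (Ω : Set Plane) (c : ℝ) :
    HasWeakGradient Ω (fun _ => c) (fun _ => 0) := by
  refine ⟨(locallyIntegrable_const c).locallyIntegrableOn Ω,
    (locallyIntegrable_const 0).locallyIntegrableOn Ω, fun φ hφ => ?_⟩
  have hgi : Integrable (gradient φ) volume :=
    hφ.continuous_gradient.integrable_of_hasCompactSupport hφ.hasCompactSupport_gradient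
  rw [setIntegral_eq_integral_of_forall_compl_eq_zero fun x hx => by
    rw [gradient_eq_zero_of_notMem_tsupport fun h => hx (hφ.tsupport_subset h), smul_zero]]
  simp only [smul_zero, integral_zero, neg_zero]
  rw [integral_smul]
  refine smul_eq_zero_of_right _ (ext_inner_left ℝ fun w => ?_)
  rw [← integral_inner hgi, inner_zero_right]
  have hfc : Continuous fun x => fderiv ℝ φ x w :=
    (hφ.smooth.continuous_fderiv (by simp)).clm_apply continuous_const
  have hfi : Integrable (fun x => fderiv ℝ φ x w) volume :=
    hfc.integrable_of_hasCompactSupport (hφ.hasCompactSupport.fderiv_apply ℝ w)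
  -- Integration by parts against the constant 1 shows that every directional derivative of `φ` has
  -- integral zero.
  have h := integral_smul_fderiv_eq_neg_fderiv_smul_of_integrable (μ := volume)
    (f := fun _ : Plane => (1 : ℝ)) (g := φ) (v := w) (by simp) (by simpa using hfi)
    (by simpa using hφ.smooth.continuous.integrable_of_hasCompactSupport hφ.hasCompactSupport)
    (fun x _ => differentiableAt_const _) (fun x _ => hφ.smooth.differentiable (by simp) x)
  simpa [real_inner_comm] using h

/-! ### The weight function -/

/-- The level sets of the distance function at positive levels are null sets. -/
lemma volume_infDist_eq_const {S : Set Plane} (hS : S.Nonempty) {ε : ℝ} (hε : 0 < ε) :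
    volume {x | Metric.infDist x S = ε} = 0 := by
  set T : Set Plane := {x | Metric.infDist x S = ε} with hT
  have hTm : MeasurableSet T :=
    (isClosed_singleton.preimage (Metric.continuous_infDist_pt S)).measurableSet
  have hfalse : ∀ᵐ x ∂(volume.restrict T), False := by
    filter_upwards [IsUnifLocDoublingMeasure.ae_tendsto_measure_inter_div volume T 2,
      ae_restrict_mem hTm] with x hx hxT
    -- Suppose `x` is a density point of `T`, and let `y` be its nearest point in the closure of
    -- `S`. Moving `2δ` from `x` towards `y` and taking the ball of radius `δ` leaves only points at
    -- distance at most `ε - δ` from `S`, so the ball misses `T`. Since `x` stays within `2δ` of the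
    -- centre, the density theorem with constant 2 would force the ratio to tend to 1.
    obtain ⟨y, hy, hxy⟩ := isClosed_closure.exists_infDist_eq_dist hS.closure x
    rw [Metric.infDist_closure, show Metric.infDist x S = ε from hxT, dist_comm, dist_eq_norm] at hxy
    have hlim := hx (l := 𝓝[>] (0 : ℝ)) (fun δ => x + (2 * δ / ε) • (y - x)) (fun δ => δ) tendsto_id
      (by
        filter_upwards [self_mem_nhdsWithin] with δ hδ
        have hδ : 0 < δ := hδ
        rw [Metric.mem_closedBall, dist_comm, dist_eq_norm, add_sub_cancel_left, norm_smul, ← hxy,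
          Real.norm_of_nonneg (by positivity)]
        exact (div_mul_cancel₀ _ hε.ne').le)
    have hzero : ∀ᶠ δ in 𝓝[>] (0 : ℝ),
        volume (T ∩ Metric.closedBall (x + (2 * δ / ε) • (y - x)) δ) /
          volume (Metric.closedBall (x + (2 * δ / ε) • (y - x)) δ) = 0 := by
      filter_upwards [Ioo_mem_nhdsGT (half_pos hε)] with δ hδ
      have hempty : T ∩ Metric.closedBall (x + (2 * δ / ε) • (y - x)) δ = ∅ := by
        refine Set.eq_empty_of_forall_notMem fun z hz => ?_
        have h1 : Metric.infDist z S = ε := hz.1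
        have h2 : Metric.infDist z S ≤ dist z y := by
          rw [← Metric.infDist_closure]
          exact Metric.infDist_le_dist_of_mem hy
        have h3 : dist (x + (2 * δ / ε) • (y - x)) y = ε - 2 * δ := by
          have h4 : x + (2 * δ / ε) • (y - x) - y = (-(1 - 2 * δ / ε)) • (y - x) := by module
          have h5 : 2 * δ / ε ≤ 1 := by
            rw [div_le_one hε]
            linarith [hδ.2]
          rw [dist_eq_norm, h4, norm_smul, norm_neg, Real.norm_of_nonneg (by linarith), ← hxy,
            sub_mul, one_mul, div_mul_cancel₀ _ hε.ne']
        have h6 := dist_triangle z (x + (2 * δ / ε) • (y - x)) y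
        have h7 : dist z (x + (2 * δ / ε) • (y - x)) ≤ δ := hz.2
        linarith [hδ.1]
      rw [hempty, measure_empty, ENNReal.zero_div]
    exact zero_ne_one (tendsto_nhds_unique (tendsto_const_nhds.congr'
      (hzero.mono fun _ h => h.symm)) hlim)
  rw [← Measure.restrict_eq_zero]
  exact ae_eq_bot.1 (Filter.eventually_false_iff_eq_bot.1 hfalse)

lemma isOpen_extendedDomain {Ω S : Set Plane} {ε : ℝ} (hΩ : IsOpen Ω) :
    IsOpen (extendedDomain Ω S ε) :=
  hΩ.inter Metric.isOpen_thickening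

lemma IsCutoff.mem_Icc_of_mem {Ω S : Set Plane} {ε : ℝ} {α : Plane → ℝ}
    (hα : IsCutoff Ω S ε α) {x : Plane} (hx : x ∈ Ω) : α x ∈ Set.Icc (0 : ℝ) 1 := by
  by_cases hS : x ∈ S
  · simp [hα.eq_one x hS]
  by_cases hx' : x ∈ extendedDomain Ω S ε
  · exact hα.mem_Icc x ⟨hx', hS⟩
  · simp [hα.eq_zero x ⟨hx, hx'⟩]

/-- The weak gradient of a weight function vanishes almost everywhere outside `Ω'`. -/
lemma IsCutoff.weakGradient_eq_zero {Ω S : Set Plane} {ε : ℝ} {α : Plane → ℝ}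
    (hα : IsCutoff Ω S ε α) (hΩ : IsOpen Ω) (hS : S.Nonempty) (hε : 0 < ε) :
    ∀ᵐ x, x ∈ Ω \ extendedDomain Ω S ε → weakGradient Ω α x = 0 := by
  obtain ⟨-, G, hG, -⟩ := hα.memW1Infty
  have hU : IsOpen (Ω ∩ {x | ε < Metric.infDist x S}) :=
    hΩ.inter (isOpen_lt continuous_const (Metric.continuous_infDist_pt S))
  have hnot : ∀ x, x ∈ extendedDomain Ω S ε ↔ x ∈ Ω ∧ Metric.infDist x S < ε := fun x => by
    rw [extendedDomain, Set.mem_inter_iff, Metric.mem_thickening_iff_infDist_lt hS]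
  have h1 := (hasWeakGradient_weakGradient hG).ae_eq_zero hU Set.inter_subset_left fun x hx =>
    hα.eq_zero x ⟨hx.1, fun h => lt_asymm hx.2 ((hnot x).1 h).2⟩
  -- Off `Ω'` only the level set remains beyond the open exterior region, and it is null.
  have h2 : ∀ᵐ x, Metric.infDist x S ≠ ε := by
    rw [ae_iff]
    simpa using volume_infDist_eq_const hS hε
  filter_upwards [h1, h2] with x hx1 hx2 hx
  refine hx1 ⟨hx.1, lt_of_le_of_ne ?_ hx2.symm⟩
  exact not_lt.1 fun h => hx.2 ((hnot x).2 ⟨hx.1, h⟩)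

/-- The source of the `√2` in the theorem: Euclidean norm against maximum norm in the plane. -/
lemma norm_le_sqrt_two_mul_of_abs_le {w : Plane} {M : ℝ} (h : ∀ i, |w i| ≤ M) :
    ‖w‖ ≤ Real.sqrt 2 * M := by
  have hM : 0 ≤ M := (abs_nonneg _).trans (h 0)
  rw [EuclideanSpace.norm_eq, ← Real.sqrt_sq hM, ← Real.sqrt_mul (by norm_num)]
  refine Real.sqrt_le_sqrt ?_
  rw [Fin.sum_univ_two, Real.norm_eq_abs, Real.norm_eq_abs]
  nlinarith [h 0, h 1, abs_nonneg (w 0), abs_nonneg (w 1)]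

lemma norm_weakGradient_le_gradientSupNorm {Ω : Set Plane} {a : Plane → ℝ} (hΩ : IsOpen Ω)
    (ha : MemW1Infty Ω a) :
    ∀ᵐ x ∂(volume.restrict Ω), ‖weakGradient Ω a x‖ ≤ Real.sqrt 2 * gradientSupNorm Ω a := by
  obtain ⟨-, G, hG, hG'⟩ := ha
  have hA := memLp_weakGradient hΩ hG hG'
  set g : Plane → Fin 2 → ℝ := fun x i => weakGradient Ω a x i with hg
  have hgL : MemLp g ⊤ (volume.restrict Ω) :=
    (PiLp.continuousLinearEquiv 2 ℝ (fun _ : Fin 2 => ℝ)).toContinuousLinearMap.comp_memLp' hA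
  filter_upwards [ae_le_eLpNormEssSup (μ := volume.restrict Ω) (f := g)] with x hx
  rw [← eLpNorm_exponent_top] at hx
  refine norm_le_sqrt_two_mul_of_abs_le fun i => ?_
  calc |weakGradient Ω a x i| ≤ ‖g x‖ := norm_le_pi_norm (g x) i
    _ ≤ gradientSupNorm Ω a :=
        (ENNReal.ofReal_le_iff_le_toReal hgL.2.ne).1 (by rwa [ofReal_norm])

/-! ### Integrability -/

lemma integrable_inner_of_memLp_two {μ : Measure Plane} {g h : Plane → Plane} (hg : MemLp g 2 μ)
    (hh : MemLp h 2 μ) : Integrable (fun x => inner ℝ (g x) (h x)) μ := by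
  refine (hg.norm.integrable_mul hh.norm).mono' (hg.1.inner hh.1) (.of_forall fun x => ?_)
  exact norm_inner_le_norm _ _

lemma integrable_of_memLp_two {F : Type*} [NormedAddCommGroup F] {Ω : Set Plane} {g : Plane → F}
    (hvol : volume Ω ≠ ⊤) (hg : MemLp g 2 (volume.restrict Ω)) : IntegrableOn g Ω := by
  have : IsFiniteMeasure (volume.restrict Ω) := ⟨by simpa using hvol.lt_top⟩
  exact memLp_one_iff_integrable.1 (hg.mono_exponent (by norm_num))

lemma setIntegral_mul_norm_le_normL2 {A : Set Plane} {e : Plane → ℝ} {q : Plane → Plane}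
    (he : MemLp e 2 (volume.restrict A)) (hq : MemLp q 2 (volume.restrict A)) :
    ∫ x in A, ‖e x‖ * ‖q x‖ ≤ normL2 A e * normL2 A q := by
  have h := integral_mul_le_Lp_mul_Lq_of_nonneg (μ := volume.restrict A) (p := 2) (q := 2)
    (f := fun x => ‖e x‖) (g := fun x => ‖q x‖) Real.HolderConjugate.two_two
    (.of_forall fun x => norm_nonneg _) (.of_forall fun x => norm_nonneg _)
    (by simpa using he.norm) (by simpa using hq.norm)
  simpa [normL2, Real.sqrt_eq_rpow] using h

/-! ### Traces -/

/-- From `0 ≤ α ≤ 1` one gets `|α(u - v)| ≤ |u - a| + |v - a|`, and the means of both terms tend to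
zero. No trace of `α` is involved. -/
lemma HasTraceAt.mul_sub {Ω : Set Plane} {u v α : Plane → ℝ} {x : Plane} {a : ℝ} (hΩ : IsOpen Ω)
    (hvol : volume Ω ≠ ⊤) (hα : ∀ y ∈ Ω, α y ∈ Set.Icc (0 : ℝ) 1) (hui : IntegrableOn u Ω)
    (hvi : IntegrableOn v Ω) (hu : HasTraceAt Ω u x a) (hv : HasTraceAt Ω v x a) :
    HasTraceAt Ω (fun y => α y * (u y - v y)) x 0 := by
  have hsum : Tendsto (fun r : ℝ => (⨍ y in Metric.ball x r ∩ Ω, |u y - a|) +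
      ⨍ y in Metric.ball x r ∩ Ω, |v y - a|) (𝓝[>] 0) (𝓝 0) := by
    simpa using Tendsto.add hu hv
  refine squeeze_zero (fun r => ?_) (fun r => ?_) hsum
  · rw [setAverage_eq]
    exact smul_nonneg (inv_nonneg.2 measureReal_nonneg) (integral_nonneg fun y => abs_nonneg _)
  · have hm : MeasurableSet (Metric.ball x r ∩ Ω) := measurableSet_ball.inter hΩ.measurableSet
    have hc : IntegrableOn (fun _ : Plane => a) Ω := integrableOn_const hvol
    have h1 : IntegrableOn (fun y => |u y - a|) (Metric.ball x r ∩ Ω) :=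
      IntegrableOn.mono_set (hui.sub hc).abs Set.inter_subset_right
    have h2 : IntegrableOn (fun y => |v y - a|) (Metric.ball x r ∩ Ω) :=
      IntegrableOn.mono_set (hvi.sub hc).abs Set.inter_subset_right
    rw [setAverage_eq, setAverage_eq, setAverage_eq, ← smul_add, ← integral_add h1 h2]
    refine smul_le_smul_of_nonneg_left ?_ (inv_nonneg.2 measureReal_nonneg)
    refine integral_mono_of_nonneg (.of_forall fun y => abs_nonneg _) (h1.add h2) ?_
    filter_upwards [ae_restrict_mem hm] with y hy
    obtain ⟨h3, h4⟩ := hα y hy.2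
    rw [sub_zero, abs_mul, abs_of_nonneg h3]
    calc α y * |u y - v y| ≤ 1 * |u y - v y| := by gcongr
      _ = |(u y - a) - (v y - a)| := by rw [one_mul, sub_sub_sub_cancel_right]
      _ ≤ |u y - a| + |v y - a| := abs_sub _ _

/-! ### Orthogonality -/

/-- The weak solution and an equilibrated flux have the same pairing with the gradients of the
functions in the test space. -/
lemma setIntegral_inner_weakGradient_sub_eq_zero {Ω ΓD ΓN : Set Plane} {f gD gN u φ : Plane → ℝ}
    {p : Plane → Plane} (hΓ_disj : Disjoint ΓN ΓD) (hΓ_union : ΓN ∪ ΓD = frontier Ω)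
    (hu : IsWeakSolution Ω ΓD ΓN f gD gN u)
    (hp_div : ∀ᵐ x ∂(volume.restrict Ω), weakDivergence Ω p x + f x = 0)
    (hp_normal : NormalTraceEqOn Ω p ΓN gN)
    (hGu : MemLp (weakGradient Ω u) 2 (volume.restrict Ω)) (hp : MemLp p 2 (volume.restrict Ω))
    (hφ : φ ∈ testSpace Ω ΓD) (hGφ : MemLp (weakGradient Ω φ) 2 (volume.restrict Ω)) :
    ∫ x in Ω, inner ℝ (weakGradient Ω u x - p x) (weakGradient Ω φ x) = 0 := by
  have hΓD : frontier Ω \ ΓN = ΓD := by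
    rw [← hΓ_union, Set.union_sdiff_left]
    exact hΓ_disj.symm.sdiff_eq_left
  have h1 := hu.2 φ hφ
  -- The part of the boundary outside `ΓN` is exactly `ΓD`, so `φ` is admissible in both identities
  -- and their boundary integrals cancel.
  have h2 := hp_normal φ hφ.1 (by rw [hΓD]; exact hφ.2.1)
  rw [normalTrace] at h2
  have h3 : ∫ x in Ω, weakDivergence Ω p x * φ x = -∫ x in Ω, f x * φ x := by
    rw [← integral_neg]
    refine integral_congr_ae ?_
    filter_upwards [hp_div] with x hx
    rw [eq_neg_of_add_eq_zero_left hx, neg_mul]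
  simp only [inner_sub_left]
  rw [integral_sub (integrable_inner_of_memLp_two hGu hGφ) (integrable_inner_of_memLp_two hp hGφ)]
  linarith

/-- Localised orthogonality: the weighted product of the gradient error and the flux error is
controlled by the gradient of the weight. -/
lemma setIntegral_cutoff_mul_inner_eq {Ω ΓD ΓN S : Set Plane} {ε : ℝ} {f gD gN u v α : Plane → ℝ}
    {p : Plane → Plane} (hΩ : IsOpen Ω) (hne : Ω.Nonempty) (hvol : volume Ω ≠ ⊤)
    (hΓ_disj : Disjoint ΓN ΓD) (hΓ_union : ΓN ∪ ΓD = frontier Ω)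
    (hα : IsCutoff Ω S ε α) (hu : IsWeakSolution Ω ΓD ΓN f gD gN u)
    (hv : v ∈ trialSpace Ω ΓD gD)
    (hp_div : ∀ᵐ x ∂(volume.restrict Ω), weakDivergence Ω p x + f x = 0)
    (hp_normal : NormalTraceEqOn Ω p ΓN gN)
    (hGu : MemLp (weakGradient Ω u) 2 (volume.restrict Ω))
    (hGv : MemLp (weakGradient Ω v) 2 (volume.restrict Ω))
    (hp : MemLp p 2 (volume.restrict Ω)) :
    ∫ x in Ω, α x * inner ℝ (weakGradient Ω u x - p x) (weakGradient Ω u x - weakGradient Ω v x) =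
      -∫ x in Ω, (u x - v x) * inner ℝ (weakGradient Ω u x - p x) (weakGradient Ω α x) := by
  classical
  obtain ⟨⟨hu2, Gu, hGu', -⟩, huT, -⟩ := hu.1
  obtain ⟨⟨hv2, Gv, hGv', -⟩, hvT, -⟩ := hv
  obtain ⟨hα2, Gα, hGα', hGα2⟩ := hα.memW1Infty
  have hui := integrable_of_memLp_two hvol hu2
  have hvi := integrable_of_memLp_two hvol hv2
  have hGui := integrable_of_memLp_two hvol hGu
  have hGvi := integrable_of_memLp_two hvol hGv
  have hGα := memLp_weakGradient hΩ hGα' hGα2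
  have he := (hasWeakGradient_weakGradient hGu').sub (hasWeakGradient_weakGradient hGv')
    hui hvi hGui hGvi
  have hW := (hasWeakGradient_weakGradient hGα').mul hΩ hvol hα2 hGα he (hui.sub hvi)
    (hGui.sub hGvi)
  set q : Plane → Plane := fun x => weakGradient Ω u x - p x with hq
  set E : Plane → Plane := fun x => weakGradient Ω u x - weakGradient Ω v x with hE
  set W : Plane → Plane := fun x => α x • E x + (u x - v x) • weakGradient Ω α x with hWdef
  have hE2 : MemLp E 2 (volume.restrict Ω) := hGu.sub hGv
  have he2 : MemLp (fun x => u x - v x) 2 (volume.restrict Ω) := hu2.sub hv2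
  have hq2 : MemLp q 2 (volume.restrict Ω) := hGu.sub hp
  have haE2 : MemLp (fun x => α x • E x) 2 (volume.restrict Ω) := hE2.smul hα2
  have heA2 : MemLp (fun x => (u x - v x) • weakGradient Ω α x) 2 (volume.restrict Ω) :=
    hGα.smul he2
  have hW2 : MemLp W 2 (volume.restrict Ω) := haE2.add heA2
  have hae2 : MemLp (fun x => α x * (u x - v x)) 2 (volume.restrict Ω) := he2.mul hα2
  have haei := integrable_of_memLp_two hvol hae2
  have hfin : IsFiniteMeasure (volume.restrict Ω) := ⟨by simpa using hvol.lt_top⟩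
  -- With `ΓD` empty, test functions must have mean zero; subtracting the mean restores this and
  -- leaves the gradient unchanged.
  set c : ℝ := if ΓD = ∅ then ⨍ x in Ω, α x * (u x - v x) else 0 with hc
  have hφW : HasWeakGradient Ω (fun x => α x * (u x - v x) - c) W := by
    simpa using hW.sub (hasWeakGradient_const Ω c) haei (integrableOn_const hvol)
      (integrable_of_memLp_two hvol hW2) integrableOn_zero
  have hφ : (fun x => α x * (u x - v x) - c) ∈ testSpace Ω ΓD := by
    refine ⟨⟨hae2.sub (memLp_const c), W, hφW, hW2⟩, ?_, fun hD => ?_⟩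
    · by_cases hD : ΓD = ∅
      · simp [TraceEqOn, hD]
      · simp only [hc, if_neg hD, sub_zero]
        filter_upwards [huT, hvT] with x hxu hxv
        exact hxu.mul_sub hΩ hvol (fun y hy => hα.mem_Icc_of_mem hy) hui hvi hxv
    · have hpos : volume.real Ω ≠ 0 :=
        (ENNReal.toReal_pos (hΩ.measure_pos volume hne).ne' hvol).ne'
      rw [integral_sub haei (integrable_const c), setIntegral_const, hc, if_pos hD, setAverage_eq,
        smul_smul, mul_inv_cancel₀ hpos, one_smul, sub_self]
  have hWae := weakGradient_ae_eq hΩ hφW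
  have key := setIntegral_inner_weakGradient_sub_eq_zero hΓ_disj hΓ_union hu hp_div hp_normal hGu
    hp hφ (memLp_weakGradient hΩ hφW hW2)
  have hint : ∫ x in Ω, inner ℝ (q x) (W x) = 0 := by
    rw [← key]
    refine integral_congr_ae ?_
    filter_upwards [hWae] with x hx
    rw [hx]
  rw [eq_neg_iff_add_eq_zero, ← hint]
  have i1 := integrable_inner_of_memLp_two hq2 haE2
  have i2 := integrable_inner_of_memLp_two hq2 heA2
  simp only [real_inner_smul_right] at i1 i2
  rw [← integral_add i1 i2]
  simp only [hWdef, inner_add_right, real_inner_smul_right]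

end WeightedHypercircle

theorem theorem4p2
    (Ω ΓD ΓN S : Set Plane) (ε : ℝ) (f gD gN u v α : Plane → ℝ) (p : Plane → Plane)
    (hΩ : IsPolygonalDomain Ω)
    (hΓ_disj : Disjoint ΓN ΓD) (hΓ_union : ΓN ∪ ΓD = frontier Ω) (hΓN : MeasurableSet ΓN)
    (hf : MemLp f 2 (volume.restrict Ω))
    (hgN : MemLp gN 2 (arcLength.restrict ΓN))
    (hS : IsOpen S) (hSΩ : S ⊆ Ω) (hε : 0 < ε)
    (hα : IsCutoff Ω S ε α)
    (hu : IsWeakSolution Ω ΓD ΓN f gD gN u)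
    (hv : v ∈ trialSpace Ω ΓD gD)
    (hp : MemHDiv Ω p)
    (hp_div : ∀ᵐ x ∂(volume.restrict Ω), weakDivergence Ω p x + f x = 0)
    (hp_normal : NormalTraceEqOn Ω p ΓN gN) :
    weightedNorm (extendedDomain Ω S ε) α
          (fun x => weakGradient Ω u x - weakGradient Ω v x) ^ 2 +
        weightedNorm (extendedDomain Ω S ε) α (fun x => weakGradient Ω u x - p x) ^ 2 ≤
      weightedNorm (extendedDomain Ω S ε) α (fun x => weakGradient Ω v x - p x) ^ 2 +
        2 * Real.sqrt 2 * gradientSupNorm Ω α *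
          normL2 (extendedDomain Ω S ε) (fun x => u x - v x) *
          normL2 (extendedDomain Ω S ε) (fun x => weakGradient Ω u x - p x) := by
  have hΩo := hΩ.isOpen
  have hvol : volume Ω ≠ ⊤ := hΩ.isBounded.measure_lt_top.ne
  obtain ⟨⟨hu2, Gu, hGu', hGu2⟩, -, -⟩ := hu.1
  obtain ⟨⟨hv2, Gv, hGv', hGv2⟩, -, -⟩ := id hv
  have hGu := memLp_weakGradient hΩo hGu' hGu2
  have hGv := memLp_weakGradient hΩo hGv' hGv2
  have hid := setIntegral_cutoff_mul_inner_eq hΩo hΩ.isConnected.nonempty hvol hΓ_disj hΓ_union hα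
    hu hv hp_div hp_normal hGu hGv hp.1
  set Ω' := extendedDomain Ω S ε with hΩ'
  have hΩ'o : IsOpen Ω' := isOpen_extendedDomain hΩo
  have hsub : Ω' ⊆ Ω := Set.inter_subset_left
  have hle : volume.restrict Ω' ≤ volume.restrict Ω := Measure.restrict_mono hsub le_rfl
  -- For empty `S` the set `Ω'` is empty and both sides are zero. The case is split off because
  -- `Metric.infDist` to the empty set is 0 by convention and does not describe `Ω'`.
  rcases S.eq_empty_or_nonempty with rfl | hSne
  · simp [hΩ', extendedDomain, weightedNorm, normL2]
  set q : Plane → Plane := fun x => weakGradient Ω u x - p x with hq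
  set E : Plane → Plane := fun x => weakGradient Ω u x - weakGradient Ω v x with hE
  have hE2 : MemLp E 2 (volume.restrict Ω') := (hGu.sub hGv).mono_measure hle
  have he2 : MemLp (fun x => u x - v x) 2 (volume.restrict Ω') := (hu2.sub hv2).mono_measure hle
  have hq2 : MemLp q 2 (volume.restrict Ω') := (hGu.sub hp.1).mono_measure hle
  have hαm : AEStronglyMeasurable α (volume.restrict Ω') := hα.memW1Infty.1.1.mono_measure hle
  have hα01 : ∀ x ∈ Ω', α x ∈ Set.Icc (0 : ℝ) 1 := fun x hx => hα.mem_Icc_of_mem (hsub hx)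
  have hαb : ∀ᵐ x ∂volume.restrict Ω', ‖α x‖ ≤ 1 := by
    filter_upwards [ae_restrict_mem hΩ'o.measurableSet] with x hx
    rw [Real.norm_of_nonneg (hα01 x hx).1]
    exact (hα01 x hx).2
  have hsq : ∀ g : Plane → Plane, weightedNorm Ω' α g ^ 2 = ∫ x in Ω', α x * ‖g x‖ ^ 2 := by
    intro g
    rw [weightedNorm, Real.sq_sqrt]
    exact setIntegral_nonneg hΩ'o.measurableSet fun x hx =>
      mul_nonneg (hα01 x hx).1 (sq_nonneg _)
  have iE : Integrable (fun x => α x * ‖E x‖ ^ 2) (volume.restrict Ω') :=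
    (hE2.integrable_norm_pow (by norm_num)).bdd_mul hαm hαb
  have iq : Integrable (fun x => α x * ‖q x‖ ^ 2) (volume.restrict Ω') :=
    (hq2.integrable_norm_pow (by norm_num)).bdd_mul hαm hαb
  have iqE : Integrable (fun x => α x * inner ℝ (q x) (E x)) (volume.restrict Ω') :=
    (integrable_inner_of_memLp_two hq2 hE2).bdd_mul hαm hαb
  have hexp : ∫ x in Ω', α x * ‖weakGradient Ω v x - p x‖ ^ 2 =
      (∫ x in Ω', α x * ‖E x‖ ^ 2) + (∫ x in Ω', α x * ‖q x‖ ^ 2) -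
        2 * ∫ x in Ω', α x * inner ℝ (q x) (E x) := by
    rw [← integral_const_mul, ← integral_add iE iq,
      ← integral_sub (by exact iE.add iq) (iqE.const_mul 2)]
    congr 1
    ext1 x
    rw [show weakGradient Ω v x - p x = q x - E x by simp only [hq, hE]; abel, norm_sub_sq_real]
    ring
  have hloc1 : ∫ x in Ω', α x * inner ℝ (q x) (E x) = ∫ x in Ω, α x * inner ℝ (q x) (E x) :=
    (setIntegral_eq_of_subset_of_forall_sdiff_eq_zero hΩo.measurableSet hsub fun x hx => by
      rw [hα.eq_zero x hx, zero_mul]).symm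
  -- Unlike `α`, its weak gradient vanishes off `Ω'` only almost everywhere.
  have hloc2 : ∫ x in Ω', (u x - v x) * inner ℝ (q x) (weakGradient Ω α x) =
      ∫ x in Ω, (u x - v x) * inner ℝ (q x) (weakGradient Ω α x) :=
    (setIntegral_eq_of_subset_of_ae_sdiff_eq_zero hΩo.nullMeasurableSet hsub (by
      filter_upwards [hα.weakGradient_eq_zero hΩo hSne hε] with x hx hxd
      rw [hx hxd, inner_zero_right, mul_zero])).symm
  have hM := ae_mono hle (norm_weakGradient_le_gradientSupNorm hΩo hα.memW1Infty)
  set M := Real.sqrt 2 * gradientSupNorm Ω α with hMdef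
  have hM0 : 0 ≤ M := mul_nonneg (Real.sqrt_nonneg _) ENNReal.toReal_nonneg
  have hbound : ‖∫ x in Ω', (u x - v x) * inner ℝ (q x) (weakGradient Ω α x)‖ ≤
      M * (normL2 Ω' (fun x => u x - v x) * normL2 Ω' q) := by
    refine le_trans ?_
      (mul_le_mul_of_nonneg_left (setIntegral_mul_norm_le_normL2 he2 hq2) hM0)
    rw [← integral_const_mul]
    refine norm_integral_le_of_norm_le ((he2.norm.integrable_mul hq2.norm).const_mul M) ?_
    filter_upwards [hM] with x hx
    calc ‖(u x - v x) * inner ℝ (q x) (weakGradient Ω α x)‖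
        ≤ ‖u x - v x‖ * (‖q x‖ * M) := by
          rw [norm_mul]
          gcongr
          exact (norm_inner_le_norm _ _).trans (by gcongr)
      _ = M * (‖u x - v x‖ * ‖q x‖) := by ring
  have hfinal : ∫ x in Ω', α x * inner ℝ (q x) (E x) ≤
      M * (normL2 Ω' (fun x => u x - v x) * normL2 Ω' q) := by
    -- Orthogonality holds only over all of `Ω`: pass from `Ω'` to `Ω`, move the derivative onto
    -- `α`, and return.
    rw [hloc1, hid, ← hloc2]
    exact (neg_le_abs _).trans hbound
  rw [hsq, hsq, hsq, hexp]
  calc _ = (∫ x in Ω', α x * ‖E x‖ ^ 2) + (∫ x in Ω', α x * ‖q x‖ ^ 2) -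
        2 * (∫ x in Ω', α x * inner ℝ (q x) (E x)) +
        2 * ∫ x in Ω', α x * inner ℝ (q x) (E x) := by ring
    _ ≤ (∫ x in Ω', α x * ‖E x‖ ^ 2) + (∫ x in Ω', α x * ‖q x‖ ^ 2) -
        2 * (∫ x in Ω', α x * inner ℝ (q x) (E x)) +
        2 * (M * (normL2 Ω' (fun x => u x - v x) * normL2 Ω' q)) := by gcongr
    _ = _ := by rw [hMdef]; ring
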